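/- Let $(\mathcal A,\tau)$ be a $C^*$-probability space with faithful trace, i.e. $\mathcal A$ is a unital $C^*$-algebra and $\tau:\mathcal A\to\mathbb C$ is a positive linear functional with $\tau(1)=1$, $\tau(ab)=\tau(ba)$ for all $a,b$, and $\tau(a^*a)=0$ only for $a=0$. For $u\in\mathcal A$ and an integer $p\ge1$ put $\|u\|_{2p}=\tau\big((uu^*)^p\big)^{1/(2p)}$. Let $G$ be a simple graph on $[L]=\{1,\dots,L\}$ with edge set $E(G)$. Unital subalgebras $\mathcal A_1,\dots,\mathcal A_L\subseteq\mathcal A$ are called $G$-independent if (i) for every $(i,j)\in E(G)$, $\mathcal A_i$ and $\mathcal A_j$ are classically independent: $ab=ba$ for all $a\in\mathcal A_i$, $b\in\mathcal A_j$, and $\tau(ab)=0$ if moreover $\tau(a)=\tau(b)=0$; and (ii) for every $k\ge1$ and $i\in[L]^k$ such that for all $j_1<j_2$ with $i_{j_1}=i_{j_2}$ there is $j_3$ with $j_1<j_3<j_2$ and $(i_{j_1},i_{j_3})\notin E(G)$, one has $\tau(a_1\cdots a_k)=0$ whenever $a_j\in\mathcal A_{i_j}$ and $\tau(a_j)=0$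 for all $j\in[k]$. A semicircle is a self-adjoint $s\in\mathcal A$ with $\tau(s^n)=\frac1{2\pi}\int_{-2}^2x^n\sqrt{4-x^2}\,dx$ for all integers $n\ge0$. Semicircles $s_1,\dots,s_L$ are $G$-independent if the unital subalgebras generated by $s_1$, …, by $s_L$ are $G$-independent. Theorem. Let $s_1,\dots,s_L\in\mathcal A$ be $G$-independent semicircles. Then for all $\alpha_1,\dots,\alpha_L\in\mathbb C$ and every integer $p\ge1$, $$\Big\|\sum_{i=1}^L\alpha_is_i\Big\|_{2p}\le C_p^{\frac1{2p}}\,\min\Big\{\sum_{i=1}^L|\alpha_i|^2\,|c^*(i)|,\ \ p\sum_{i=1}^L|\alpha_i|^2\Big\}^{1/2},$$ where $|c^*(i)|$ is the size of the largest clique of $G$ containing $i$ and $C_p=\frac1{p+1}\binom{2p}{p}$ is the $p$-th Catalan number. In particular, $$\Big\|\sum_{i=1}^L\alpha_is_i\Big\|_{2p}\le C_p^{\frac1{2p}}\,\sqrt{\min\{\omega(G),p\}}\,\Big(\sum_{i=1}^L|\alpha_i|^2\Big)^{1/2},$$ where $\omega(G)$ is the clique number of $G$. -/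

import Mathlib

open scoped ComplexOrder

/-- A faithful tracial state on a unital C⋆-algebra `A`.  Together with the positive linear
functional `τ`, this makes `(A, τ)` a C⋆-probability space with faithful trace. -/
structure IsFaithfulTracialState {A : Type*} [CStarAlgebra A] [PartialOrder A]
    [StarOrderedRing A] (τ : A →ₚ[ℂ] ℂ) : Prop where
  map_one : τ 1 = 1
  map_mul_comm : ∀ a b : A, τ (a * b) = τ (b * a)
  faithful : ∀ a : A, τ (star a * a) = 0 → a = 0

/-- Classical (tensor) independence of two unital subalgebras: they commute, and products of
centered elements are centered. -/
structure ClassicallyIndependent {A : Type*} [CStarAlgebra A] [PartialOrder A]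
    (τ : A →ₚ[ℂ] ℂ) (B C : Subalgebra ℂ A) : Prop where
  commute : ∀ b ∈ B, ∀ c ∈ C, b * c = c * b
  map_mul_eq_zero : ∀ b ∈ B, ∀ c ∈ C, τ b = 0 → τ c = 0 → τ (b * c) = 0

/-- `G`-independence of a family of unital subalgebras indexed by the vertices of the simple
graph `G`: adjacent subalgebras are classically independent, and `τ (a₁ ⋯ a_k) = 0` for centered
`a_j` in the subalgebra number `i_j`, as soon as any two equal indices `i_{j₁} = i_{j₂}` with
`j₁ < j₂` are separated by some `j₁ < j₃ < j₂` for which `i_{j₁}` and `i_{j₃}` are not adjacent. -/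
structure GIndependent {A ι : Type*} [CStarAlgebra A] [PartialOrder A]
    (τ : A →ₚ[ℂ] ℂ) (G : SimpleGraph ι) (B : ι → Subalgebra ℂ A) : Prop where
  classicallyIndependent : ∀ i j : ι, G.Adj i j → ClassicallyIndependent τ (B i) (B j)
  map_prod_eq_zero : ∀ (k : ℕ) (i : Fin k → ι), 1 ≤ k →
    (∀ j₁ j₂ : Fin k, j₁ < j₂ → i j₁ = i j₂ → ∃ j₃, j₁ < j₃ ∧ j₃ < j₂ ∧ ¬ G.Adj (i j₁) (i j₃)) →
    ∀ a : Fin k → A, (∀ j, a j ∈ B (i j)) → (∀ j, τ (a j) = 0) → τ (List.ofFn a).prod = 0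

/-- A standard semicircle (semicircular element): a self-adjoint element whose distribution is
the semicircle law of mean `0` and variance `1`, i.e. the law on `[-2, 2]` with density
`√(4 - x²) / (2π)`. -/
structure IsSemicircle {A : Type*} [CStarAlgebra A] [PartialOrder A]
    (τ : A →ₚ[ℂ] ℂ) (s : A) : Prop where
  isSelfAdjoint : IsSelfAdjoint s
  moment : ∀ n : ℕ,
    τ (s ^ n) = ((∫ x in (-2 : ℝ)..2, x ^ n * (√(4 - x ^ 2) / (2 * Real.pi)) : ℝ) : ℂ)

/-- A family of `G`-independent (standard) semicircles: the unital algebras generated by the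
individual (self-adjoint) elements are `G`-independent. -/
structure GIndependentSemicircles {A ι : Type*} [CStarAlgebra A] [PartialOrder A]
    (τ : A →ₚ[ℂ] ℂ) (G : SimpleGraph ι) (s : ι → A) : Prop where
  isSemicircle : ∀ i, IsSemicircle τ (s i)
  gIndependent : GIndependent τ G (fun i => Algebra.adjoin ℂ {s i})

/-- The noncommutative norm `‖u‖_{2p} = τ((u u⋆)^p)^{1/(2p)}`.  For a positive functional `τ`, the
number `τ((u u⋆)^p)` is real and nonnegative, so nothing is lost by taking its real part. -/
noncomputable def ncNorm {A : Type*} [CStarAlgebra A] [PartialOrder A]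
    (τ : A →ₚ[ℂ] ℂ) (p : ℕ) (u : A) : ℝ :=
  (τ ((u * star u) ^ p)).re ^ (1 / (2 * (p : ℝ)))

/-- The size of the largest clique of `G` containing the vertex `i`. -/
noncomputable def cliqueNumAt {ι : Type*} (G : SimpleGraph ι) (i : ι) : ℕ :=
  sSup {n | ∃ t : Finset ι, G.IsNClique n t ∧ i ∈ t}

/-!
The moments of `G`-independent semicircles are vacuum expectations of field operators on a Fock
space. Its orthonormal basis is indexed by the words `q` in the vertices, up to exchanges of
neighbouring letters that are adjacent in `G` (`PCWord G`); the left creation operator `l i` puts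
the letter `i` in front of a word, and `s i` corresponds to `l i + (l i)⋆`. The link is the Wick
product `PCWord.wick s q`, an element of the algebra satisfying the three-term recursion of the
field operators (`PCWord.wick_cons`). Splitting off maximal powers of letters turns it into a
product of Chebyshev polynomials of the `s i`, each centered for the semicircle law, along a
reduced sequence of indices. Hence `G`-independence makes it centered unless `q` is empty
(`GIndependentSemicircles.map_wick`), and `τ ((u u⋆) ^ p)` is the vacuum coefficient of a product
of `2 p` field operators applied to the vacuum.

Field operators change the length of words by one, so this coefficient is a sum over the
`catalan p` Dyck paths of length `2 p` of products of creation and annihilation operators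
(the proof keeps track of the parts of fixed degree instead of single paths, which produces the
numbers `ballot n k`). The key point is that the letters which can be moved to the front of a word
form a clique. Their number is thus at most `|c^*(i)|` for each letter `i` among them, and it is at
most the length of the word. By a weighted Cauchy-Schwarz inequality, `∑ i, α i • l i` therefore
has squared norm at most `∑ i, ‖α i‖ ^ 2 * m i` with `m i = |c^*(i)|`, and also with `m i = p` as
long as only words of length at most `p` occur (`PCWord.l2NormSq_creation_degreePart_le`); Dyck
paths of length `2 p` do not rise above `p`. Each Dyck path thus contributes at most the `p`-th
power of this sum.
-/

/-! ### Partially commutative words -/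

/-- The equivalence of words over the vertices of `G` that identifies words differing by
exchanges of neighbouring adjacent letters.  It is encoded by projections: two words are equivalent
iff, for all non-adjacent `i, j` (possibly equal), they have the same subword on the letters
`i, j`.  This makes left cancellation immediate. -/
def traceSetoid {ι : Type*} [DecidableEq ι] (G : SimpleGraph ι) : Setoid (List ι) where
  r w w' := ∀ i j, ¬ G.Adj i j →
    w.filter (fun x => decide (x = i ∨ x = j)) = w'.filter (fun x => decide (x = i ∨ x = j))
  iseqv :=
    { refl := fun _ _ _ _ => rfl
      symm := fun h i j hij => (h i j hij).symm
      trans := fun h h' i j hij => (h i j hij).trans (h' i j hij) }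

/-- The trace monoid of `G` as a type: words over the vertices up to exchanging neighbouring
letters that are adjacent in `G`.  Only multiplication by one letter on the left, `PCWord.cons`,
is needed. -/
def PCWord {ι : Type*} [DecidableEq ι] (G : SimpleGraph ι) : Type _ := Quotient (traceSetoid G)

namespace PCWord

variable {ι : Type*} [DecidableEq ι] {G : SimpleGraph ι}

/-- The class of a word. -/
def mk (w : List ι) : PCWord G := Quotient.mk (traceSetoid G) w

/-- The empty word. -/
def nil : PCWord G := mk []

lemma mk_eq_mk {w w' : List ι} : (mk w : PCWord G) = mk w' ↔ ∀ i j, ¬ G.Adj i j →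
    w.filter (fun x => decide (x = i ∨ x = j)) = w'.filter (fun x => decide (x = i ∨ x = j)) :=
  Quotient.eq (r := traceSetoid G)

lemma ind_mk {P : PCWord G → Prop} (h : ∀ w, P (mk w)) (q : PCWord G) : P q :=
  Quotient.inductionOn q h

/-- Left multiplication by a letter. -/
def cons (i : ι) : PCWord G → PCWord G :=
  Quotient.map (fun w => i :: w) fun w w' h k l hkl => by
    simp only [List.filter_cons, h k l hkl]

@[simp] lemma cons_mk (i : ι) (w : List ι) : cons i (mk w : PCWord G) = mk (i :: w) := rfl

lemma cons_injective (i : ι) : Function.Injective (cons i : PCWord G → PCWord G) := by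
  intro q r
  induction q using ind_mk with | _ w
  induction r using ind_mk with | _ v
  simp only [cons_mk, mk_eq_mk]
  intro h k l hkl
  have := h k l hkl
  simp only [List.filter_cons] at this
  split_ifs at this
  · exact List.cons_injective this
  · exact this

lemma cons_comm {i j : ι} (h : G.Adj i j) (q : PCWord G) :
    cons i (cons j q) = cons j (cons i q) := by
  induction q using ind_mk with | _ w
  simp only [cons_mk, mk_eq_mk]
  intro k l hkl
  have hij := h.ne
  simp only [List.filter_cons]
  by_cases hi : i = k ∨ i = l <;> by_cases hj : j = k ∨ j = l <;> simp only [hi, hj] <;>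
    simp
  have hs := h.symm
  rcases hi with rfl | rfl <;> rcases hj with rfl | rfl <;>
    first | exact absurd rfl hij | exact absurd h hkl | exact absurd hs hkl

lemma perm_of_mk_eq_mk {w w' : List ι} (h : (mk w : PCWord G) = mk w') : w.Perm w' := by
  rw [List.perm_iff_count]
  intro a
  have := congrArg List.length (mk_eq_mk.1 h a a (G.loopless.irrefl a))
  simpa [List.count_eq_length_filter, beq_iff_eq, Bool.beq_eq_decide_eq] using this

/-- The number of letters of a word. -/
def length : PCWord G → ℕ :=
  Quotient.lift List.length fun _ _ h => (perm_of_mk_eq_mk (Quotient.sound h)).length_eq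

@[simp] lemma length_mk (w : List ι) : (mk w : PCWord G).length = w.length := rfl

@[simp] lemma length_nil : (nil : PCWord G).length = 0 := rfl

@[simp] lemma length_cons (i : ι) (q : PCWord G) : (cons i q).length = q.length + 1 := by
  induction q using ind_mk with | _ w
  rfl

lemma cons_ne_nil (i : ι) (q : PCWord G) : cons i q ≠ nil := fun h => by
  simpa using congrArg length h

lemma length_eq_zero_iff {q : PCWord G} : q.length = 0 ↔ q = nil := by
  induction q using ind_mk with | _ w
  constructor
  · intro h
    rw [length_mk, List.length_eq_zero_iff] at h
    rw [h, nil]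
  · rintro h
    rw [h, length_nil]

lemma exists_eq_cons {q : PCWord G} (h : q ≠ nil) : ∃ i t, q = cons i t := by
  induction q using ind_mk with | _ w
  cases w with
  | nil => exact absurd rfl h
  | cons i w => exact ⟨i, mk w, rfl⟩

lemma mk_append_cons {a : List ι} {j : ι} (h : ∀ k ∈ a, G.Adj k j) (b : List ι) :
    (mk (a ++ j :: b) : PCWord G) = cons j (mk (a ++ b)) := by
  induction a with
  | nil => rfl
  | cons k a ih =>
    rw [List.cons_append, ← cons_mk, ih fun x hx => h x (List.mem_cons_of_mem _ hx),
      cons_comm (h k List.mem_cons_self)]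
    rfl

/-- Confluence: two different first letters of a word are adjacent and can both be split off. -/
lemma exists_of_cons_eq_cons {i j : ι} (hij : i ≠ j) {q r : PCWord G}
    (h : cons i q = cons j r) : G.Adj i j ∧ ∃ t, q = cons j t ∧ r = cons i t := by
  induction q using ind_mk with | _ w
  induction r using ind_mk with | _ v
  have hf := mk_eq_mk.1 h
  have hadj : G.Adj i j := by
    by_contra hn
    have := hf i j hn
    simp [hij] at this
  refine ⟨hadj, ?_⟩
  have hj : j ∈ w := by
    have : j ∈ i :: w := (perm_of_mk_eq_mk h).mem_iff.2 List.mem_cons_self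
    simpa [hij.symm] using this
  obtain ⟨a, b, rfl, hja⟩ := List.eq_append_cons_of_mem hj
  have ha : ∀ k ∈ a, G.Adj k j := by
    intro k hk
    by_contra hn
    have hkj : k ≠ j := fun e => hja (e ▸ hk)
    by_cases hik : i = k
    · exact hn (hik ▸ hadj)
    have h1 := hf k j hn
    rw [List.filter_cons_of_neg (by simp [hik, hij]), List.filter_append,
      List.filter_cons_of_pos (by simp)] at h1
    -- The subword on `k, j` starts with `k` on the left and with `j` on the right.
    rcases hfa : a.filter (fun x => decide (x = k ∨ x = j)) with _ | ⟨c, a'⟩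
    · have : k ∈ a.filter (fun x => decide (x = k ∨ x = j)) := by simp [hk]
      rw [hfa] at this
      simp at this
    · have hc : c ∈ a := (List.mem_filter.1 (hfa ▸ List.mem_cons_self)).1
      rw [hfa] at h1
      simp only [List.cons_append, List.filter_cons, or_true, decide_true, if_true,
        List.cons.injEq] at h1
      exact hja (h1.1 ▸ hc)
  have hw := mk_append_cons ha b
  refine ⟨mk (a ++ b), hw, ?_⟩
  apply cons_injective j
  rw [← h, hw, cons_comm hadj]

/-- The set of first letters of a word: those that can be moved to the front. -/
def firstLetters (q : PCWord G) : Set ι := {i | q ∈ Set.range (cons i)}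

lemma isClique_firstLetters (q : PCWord G) : G.IsClique q.firstLetters := by
  rintro i ⟨t, rfl⟩ j ⟨t', h⟩ hij
  exact (exists_of_cons_eq_cons hij h.symm).1

lemma firstLetters_mk_subset (w : List ι) : (mk w : PCWord G).firstLetters ⊆ {i | i ∈ w} := by
  rintro i ⟨t, h⟩
  induction t using ind_mk with | _ v
  exact (perm_of_mk_eq_mk h).mem_iff.1 List.mem_cons_self

lemma card_le_length_of_subset_firstLetters {q : PCWord G} {t : Finset ι}
    (h : (t : Set ι) ⊆ q.firstLetters) : t.card ≤ q.length := by
  induction q using ind_mk with | _ w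
  refine (Finset.card_le_card (t := w.toFinset) fun i hi => ?_).trans (List.toFinset_card_le w)
  exact List.mem_toFinset.2 (firstLetters_mk_subset w (h hi))

instance : Nonempty (PCWord G) := ⟨nil⟩

/-- Removal of a first letter `i`; the value is junk when `i` is not a first letter. -/
noncomputable def uncons (i : ι) (q : PCWord G) : PCWord G :=
  Function.invFun (cons i) q

@[simp] lemma uncons_cons (i : ι) (q : PCWord G) : uncons i (cons i q) = q :=
  Function.leftInverse_invFun (cons_injective i) q

end PCWord

namespace PCWord

variable {ι : Type*} [DecidableEq ι] {G : SimpleGraph ι}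

lemma mem_firstLetters_cons {i j : ι} (h : G.Adj i j) {q : PCWord G}
    (hq : i ∈ q.firstLetters) : i ∈ (cons j q).firstLetters := by
  obtain ⟨t, rfl⟩ := hq
  exact ⟨cons j t, cons_comm h t⟩

lemma mem_firstLetters_cons_iff {i j : ι} (h : G.Adj i j) {q : PCWord G} :
    i ∈ (cons j q).firstLetters ↔ i ∈ q.firstLetters := by
  refine ⟨?_, mem_firstLetters_cons h⟩
  rintro ⟨t, ht⟩
  obtain ⟨-, v, -, hv⟩ := exists_of_cons_eq_cons h.ne ht
  exact ⟨v, hv.symm⟩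

@[simp] lemma self_mem_firstLetters_cons (i : ι) (q : PCWord G) :
    i ∈ (cons i q).firstLetters := ⟨q, rfl⟩

lemma cons_uncons {i : ι} {q : PCWord G} (h : i ∈ q.firstLetters) : cons i (uncons i q) = q := by
  obtain ⟨t, rfl⟩ := h
  rw [uncons_cons]

lemma uncons_cons_of_adj {i j : ι} (h : G.Adj i j) {q : PCWord G} (hq : i ∈ q.firstLetters) :
    uncons i (cons j q) = cons j (uncons i q) := by
  obtain ⟨t, rfl⟩ := hq
  rw [uncons_cons, ← cons_comm h, uncons_cons]

/-! ### Wick products -/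

section Wick

variable {A : Type*} [Ring A]

open scoped Classical in
/-- The Wick product of a word in the letters `s i`: the element of `A` determined by
`wick s nil = 1` and `s i * wick s q = wick s (cons i q) + wick s (uncons i q)`, the last term
being present only if `i` is a first letter of `q`.  The recursion splits off an arbitrary first
letter; `wick_cons` shows that the choice does not matter. -/
noncomputable def wick (s : ι → A) (q : PCWord G) : A :=
  if h : q = nil then 1 else
    have h' := exists_eq_cons h
    have h1 : h'.choose_spec.choose.length < q.length := by
      conv_rhs => rw [h'.choose_spec.choose_spec, length_cons]
      exact Nat.lt_succ_self _
    s h'.choose * wick s h'.choose_spec.choose -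
      if h2 : h'.choose ∈ h'.choose_spec.choose.firstLetters then
        have : (uncons h'.choose h'.choose_spec.choose).length < q.length := by
          have := congrArg length (cons_uncons h2)
          rw [length_cons] at this
          omega
        wick s (uncons h'.choose h'.choose_spec.choose)
      else 0
termination_by q.length

open scoped Classical in
/-- The annihilation term in the recursion for Wick products. -/
noncomputable def wickRemove (s : ι → A) (i : ι) (q : PCWord G) : A :=
  if i ∈ q.firstLetters then wick s (uncons i q) else 0

@[simp] lemma wick_nil (s : ι → A) : wick s (nil : PCWord G) = 1 := by
  rw [wick]
  simp

lemma exists_wick_eq (s : ι → A) {q : PCWord G} (h : q ≠ nil) :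
    ∃ i t, q = cons i t ∧ wick s q = s i * wick s t - wickRemove s i t := by
  have h' := exists_eq_cons h
  refine ⟨h'.choose, h'.choose_spec.choose, h'.choose_spec.choose_spec, ?_⟩
  rw [wick, dif_neg h]
  simp only [wickRemove, dite_eq_ite]

lemma wickRemove_cons_self (s : ι → A) (i : ι) (q : PCWord G) :
    wickRemove s i (cons i q) = wick s q := by
  simp [wickRemove]

lemma wickRemove_of_notMem (s : ι → A) {i : ι} {q : PCWord G} (h : i ∉ q.firstLetters) :
    wickRemove s i q = 0 := if_neg h

/-- The recursion for Wick products holds for every first letter.  Two choices of the first letter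
are compared by confluence (`exists_of_cons_eq_cons`). -/
lemma wick_cons {s : ι → A} (hs : ∀ i j, G.Adj i j → s i * s j = s j * s i) (i : ι)
    (q : PCWord G) : wick s (cons i q) = s i * wick s q - wickRemove s i q := by
  classical
  induction hn : q.length using Nat.strong_induction_on generalizing i q with
  | _ n ih =>
  obtain ⟨j, r, hr, hw⟩ := exists_wick_eq s (cons_ne_nil i q)
  rw [hw]
  by_cases hij : i = j
  · subst hij
    rw [cons_injective i hr]
  obtain ⟨hadj, v, rfl, rfl⟩ := exists_of_cons_eq_cons hij hr
  have hv : v.length < n := by rw [← hn, length_cons]; exact Nat.lt_succ_self _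
  rw [ih _ hv i v rfl, ih _ hv j v rfl]
  have key : ∀ k l, G.Adj k l → wickRemove s k (cons l v) =
      s l * wickRemove s k v -
        wickRemove s l (uncons k v) * (if k ∈ v.firstLetters then 1 else 0) := by
    intro k l hkl
    by_cases hk : k ∈ v.firstLetters
    · obtain ⟨t, rfl⟩ := hk
      rw [wickRemove, if_pos (mem_firstLetters_cons hkl (self_mem_firstLetters_cons _ _)),
        uncons_cons_of_adj hkl (self_mem_firstLetters_cons _ _), wickRemove_cons_self, uncons_cons,
        ih t.length _ l t rfl]
      · simp
      · rw [length_cons] at hv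
        omega
    · rw [wickRemove_of_notMem s hk,
        wickRemove_of_notMem s (by rwa [mem_firstLetters_cons_iff hkl])]
      simp [hk]
  have key2 : wickRemove s j (uncons i v) * (if i ∈ v.firstLetters then 1 else 0) =
      wickRemove s i (uncons j v) * (if j ∈ v.firstLetters then 1 else 0) := by
    by_cases hi : i ∈ v.firstLetters
    · obtain ⟨t, rfl⟩ := hi
      by_cases hj : j ∈ t.firstLetters
      · obtain ⟨z, rfl⟩ := hj
        have h1 : j ∈ (cons i (cons j z)).firstLetters :=
          mem_firstLetters_cons hadj.symm (self_mem_firstLetters_cons _ _)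
        rw [uncons_cons_of_adj hadj.symm (self_mem_firstLetters_cons _ _)]
        simp [h1, wickRemove_cons_self]
      · have h1 : j ∉ (cons i t).firstLetters := by rwa [mem_firstLetters_cons_iff hadj.symm]
        simp [h1, wickRemove_of_notMem s hj]
    · by_cases hj : j ∈ v.firstLetters
      · obtain ⟨t, rfl⟩ := hj
        have h1 : i ∉ t.firstLetters := by rwa [mem_firstLetters_cons_iff hadj] at hi
        simp [hi, wickRemove_of_notMem s h1]
      · simp [hi, hj]
  rw [key i j hadj, key j i hadj.symm, key2, mul_sub, mul_sub, ← mul_assoc, ← mul_assoc,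
    hs i j hadj]
  abel

variable [Algebra ℂ A]

/-- Powers of one letter contribute a Chebyshev polynomial to a Wick product. -/
lemma wick_iterate_cons {s : ι → A} (hs : ∀ i j, G.Adj i j → s i * s j = s j * s i) {i : ι}
    {q : PCWord G} (hq : i ∉ q.firstLetters) (k : ℕ) :
    wick s ((cons i)^[k] q) =
      Polynomial.aeval (s i) (Polynomial.Chebyshev.S ℂ (k : ℤ)) * wick s q := by
  induction k using Nat.strong_induction_on with
  | _ k ih =>
  match k with
  | 0 => simp
  | 1 => simp [wick_cons hs, wickRemove_of_notMem s hq]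
  | k + 2 =>
    rw [Function.iterate_succ_apply', wick_cons hs, ih (k + 1) (by omega),
      Function.iterate_succ_apply', wickRemove_cons_self, ih k (by omega)]
    push_cast
    rw [Polynomial.Chebyshev.S_add_two, map_sub, map_mul, Polynomial.aeval_X, sub_mul, mul_assoc]

end Wick

/-! ### Reduced syllable decompositions -/

/-- The word with given syllables: a pair `(i, k)` stands for the power `k + 1` of the
letter `i`. -/
def ofSyllables (l : List (ι × ℕ)) : PCWord G :=
  l.foldr (fun x q => (cons x.1)^[x.2 + 1] q) nil

@[simp] lemma ofSyllables_cons (x : ι × ℕ) (l : List (ι × ℕ)) :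
    (ofSyllables (x :: l) : PCWord G) = (cons x.1)^[x.2 + 1] (ofSyllables l) := rfl

variable (G) in
/-- A list of syllables is reduced if the letter of no syllable is a first letter of the word
formed by the syllables to its right. -/
def IsReduced : List (ι × ℕ) → Prop
  | [] => True
  | x :: l => x.1 ∉ (ofSyllables l : PCWord G).firstLetters ∧ IsReduced l

lemma exists_eq_iterate_cons (i : ι) (q : PCWord G) :
    ∃ k t, q = (cons i)^[k] t ∧ i ∉ t.firstLetters ∧ t.length ≤ q.length := by
  induction hn : q.length using Nat.strong_induction_on generalizing q with
  | _ n ih =>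
  by_cases h : i ∈ q.firstLetters
  · obtain ⟨q', rfl⟩ := h
    rw [length_cons] at hn
    obtain ⟨k, t, rfl, ht, hl⟩ := ih q'.length (by omega) q' rfl
    exact ⟨k + 1, t, (Function.iterate_succ_apply' _ _ _).symm, ht, by omega⟩
  · exact ⟨0, q, rfl, h, hn.le⟩

lemma exists_isReduced (q : PCWord G) : ∃ l, ofSyllables l = q ∧ IsReduced G l := by
  induction hn : q.length using Nat.strong_induction_on generalizing q with
  | _ n ih =>
  by_cases h : q = nil
  · exact ⟨[], h.symm, trivial⟩
  · obtain ⟨i, q', rfl⟩ := exists_eq_cons h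
    obtain ⟨k, t, rfl, ht, hl⟩ := exists_eq_iterate_cons i q'
    rw [length_cons] at hn
    obtain ⟨l, rfl, hr⟩ := ih t.length (by omega) t rfl
    exact ⟨(i, k) :: l, Function.iterate_succ_apply' _ _ _, ht, hr⟩

lemma mem_firstLetters_iterate_cons {i j : ι} (h : G.Adj i j) {q : PCWord G}
    (hq : i ∈ q.firstLetters) (k : ℕ) : i ∈ ((cons j)^[k] q).firstLetters := by
  induction k with
  | zero => exact hq
  | succ k ih =>
    rw [Function.iterate_succ_apply']
    exact mem_firstLetters_cons h ih

lemma mem_firstLetters_ofSyllables {i : ι} (l : List (ι × ℕ)) (m : ℕ) (hm : m < l.length)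
    (hi : l[m].1 = i) (h : ∀ (r : ℕ) (hr : r < m), G.Adj i l[r].1) :
    i ∈ (ofSyllables l : PCWord G).firstLetters := by
  induction l generalizing m with
  | nil => simp at hm
  | cons x l ih =>
    rcases m with _ | m
    · simp only [List.getElem_cons_zero] at hi
      subst hi
      rw [ofSyllables_cons, Function.iterate_succ_apply']
      exact self_mem_firstLetters_cons _ _
    · rw [ofSyllables_cons]
      refine mem_firstLetters_iterate_cons (h 0 (Nat.succ_pos _)) ?_ _
      exact ih m (by simpa using hm) (by simpa using hi)
        fun r hr => by simpa using h (r + 1) (by omega)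

/-- Reduced lists of syllables satisfy the separation condition in the definition of
`G`-independence. -/
lemma IsReduced.exists_not_adj {l : List (ι × ℕ)} (hl : IsReduced G l) (n m : ℕ) (hnm : n < m)
    (hm : m < l.length) (h : l[n].1 = l[m].1) :
    ∃ (r : ℕ) (_ : n < r) (_ : r < m), ¬ G.Adj l[n].1 l[r].1 := by
  induction l generalizing n m with
  | nil => simp at hm
  | cons x l ih =>
    obtain ⟨m, rfl⟩ : ∃ m', m = m' + 1 := ⟨m - 1, by omega⟩
    rcases n with _ | n
    · by_contra! hc
      refine hl.1 (mem_firstLetters_ofSyllables l m (by simpa using hm) (by simpa using h.symm) ?_)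
      intro r hr
      simpa using hc (r + 1) (by omega) (by omega)
    · obtain ⟨r, h1, h2, h3⟩ := ih hl.2 n m (by omega) (by simpa using hm) (by simpa using h)
      exact ⟨r + 1, by omega, by omega, by simpa using h3⟩

lemma wick_ofSyllables {A : Type*} [Ring A] [Algebra ℂ A] {s : ι → A}
    (hs : ∀ i j, G.Adj i j → s i * s j = s j * s i) {l : List (ι × ℕ)} (hl : IsReduced G l) :
    wick s (ofSyllables l : PCWord G) = (l.map fun x =>
      Polynomial.aeval (s x.1) (Polynomial.Chebyshev.S ℂ ((x.2 + 1 : ℕ) : ℤ))).prod := by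
  induction l with
  | nil => exact wick_nil s
  | cons x l ih =>
    rw [ofSyllables_cons, wick_iterate_cons hs hl.1, ih hl.2, List.map_cons, List.prod_cons]

end PCWord

/-! ### Wick products are centered -/

/-- The Chebyshev polynomials `S k` of positive degree are orthogonal to `1` for the semicircle
law. -/
lemma integral_chebyshev_S_mul_semicircle (k : ℕ) :
    ∫ x in (-2 : ℝ)..2, (Polynomial.Chebyshev.S ℝ ((k + 1 : ℕ) : ℤ)).eval x *
      (√(4 - x ^ 2) / (2 * Real.pi)) = 0 := by
  set f : ℝ → ℝ := fun x => (Polynomial.Chebyshev.S ℝ ((k + 1 : ℕ) : ℤ)).eval x *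
    (√(4 - x ^ 2) / (2 * Real.pi)) with hf
  have hcos : ∀ n : ℕ, n ≠ 0 → ∫ θ in (0 : ℝ)..Real.pi, Real.cos (n * θ) = 0 := by
    intro n hn
    rw [intervalIntegral.integral_comp_mul_left _ (Nat.cast_ne_zero.2 hn), integral_cos]
    simp [Real.sin_nat_mul_pi]
  have hci : ∀ n : ℕ, IntervalIntegrable (fun θ : ℝ => Real.cos (n * θ)) MeasureTheory.volume 0
      Real.pi := fun n =>
    (by fun_prop : Continuous fun θ : ℝ => Real.cos (n * θ)).intervalIntegrable _ _
  have hfc : Continuous f :=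
    (Polynomial.continuous _).mul (by fun_prop)
  -- The substitution `x = 2 cos θ`.
  have hsub : ∫ θ in (0 : ℝ)..Real.pi, (f ∘ fun θ => 2 * Real.cos θ) θ * (2 * -Real.sin θ) =
      ∫ x in (2 * Real.cos 0)..(2 * Real.cos Real.pi), f x :=
    intervalIntegral.integral_comp_mul_deriv (fun θ _ => (Real.hasDerivAt_cos θ).const_mul 2)
      (by fun_prop) hfc
  rw [Real.cos_zero, Real.cos_pi, mul_one, mul_neg_one,
    intervalIntegral.integral_symm (-2) 2] at hsub
  rw [← neg_eq_zero, ← hsub]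
  have hpt : ∀ θ ∈ Set.uIcc 0 Real.pi,
      (f ∘ fun θ => 2 * Real.cos θ) θ * (2 * -Real.sin θ) =
        -(1 / Real.pi) * (Real.cos ((k + 1 : ℕ) * θ) - Real.cos ((k + 3 : ℕ) * θ)) := by
    intro θ hθ
    rw [Set.uIcc_of_le Real.pi_pos.le] at hθ
    have hsin := Real.sin_nonneg_of_mem_Icc hθ
    have hsqrt : √(4 - (2 * Real.cos θ) ^ 2) = 2 * Real.sin θ := by
      rw [show 4 - (2 * Real.cos θ) ^ 2 = (2 * Real.sin θ) ^ 2 by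
        nlinarith [Real.sin_sq_add_cos_sq θ]]
      exact Real.sqrt_sq (by positivity)
    have hS := Polynomial.Chebyshev.S_two_mul_real_cos θ ((k + 1 : ℕ) : ℤ)
    have h1 : Real.cos ((k + 1 : ℕ) * θ) - Real.cos ((k + 3 : ℕ) * θ) =
        2 * Real.sin ((((k + 1 : ℕ) : ℤ) + 1) * θ) * Real.sin θ := by
      rw [Real.cos_sub_cos]
      rw [show ((k + 1 : ℕ) * θ - (k + 3 : ℕ) * θ) / 2 = -θ by push_cast; ring,
        show ((k + 1 : ℕ) * θ + (k + 3 : ℕ) * θ) / 2 = ((((k + 1 : ℕ) : ℤ) : ℝ) + 1) * θ by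
          push_cast; ring, Real.sin_neg]
      ring
    rw [h1, ← hS]
    simp only [hf, Function.comp_apply, hsqrt]
    field_simp
  rw [intervalIntegral.integral_congr hpt, intervalIntegral.integral_const_mul,
    intervalIntegral.integral_sub (hci _) (hci _), hcos _ (by omega), hcos _ (by omega)]
  simp

lemma IsSemicircle.map_chebyshev_S {A : Type*} [CStarAlgebra A] [PartialOrder A]
    {τ : A →ₚ[ℂ] ℂ} {s : A} (hs : IsSemicircle τ s) (k : ℕ) :
    τ (Polynomial.aeval s (Polynomial.Chebyshev.S ℂ ((k + 1 : ℕ) : ℤ))) = 0 := by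
  have key : ∀ P : Polynomial ℝ, τ (Polynomial.aeval s (P.map (algebraMap ℝ ℂ))) =
      ((∫ x in (-2 : ℝ)..2, P.eval x * (√(4 - x ^ 2) / (2 * Real.pi)) : ℝ) : ℂ) := by
    intro P
    have hc : ∀ P : Polynomial ℝ,
        Continuous fun x : ℝ => P.eval x * (√(4 - x ^ 2) / (2 * Real.pi)) := fun P =>
      P.continuous.mul (by fun_prop)
    induction P using Polynomial.induction_on' with
    | add P Q hP hQ =>
      rw [Polynomial.map_add, map_add, map_add, hP, hQ, ← Complex.ofReal_add,
        ← intervalIntegral.integral_add ((hc P).intervalIntegrable _ _)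
          ((hc Q).intervalIntegrable _ _)]
      simp only [Polynomial.eval_add, add_mul]
    | monomial n a =>
      have := hs.moment n
      simp only [Polynomial.map_monomial, Polynomial.aeval_monomial, Polynomial.eval_monomial,
        mul_assoc, intervalIntegral.integral_const_mul, Complex.ofReal_mul]
      rw [← this, ← Algebra.smul_def, map_smul, smul_eq_mul]
      rfl
  rw [← Polynomial.Chebyshev.map_S (algebraMap ℝ ℂ), key, integral_chebyshev_S_mul_semicircle,
    Complex.ofReal_zero]

/-- Wick products of nonempty words are centered. -/
lemma GIndependentSemicircles.map_wick {A ι : Type*} [DecidableEq ι] [CStarAlgebra A]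
    [PartialOrder A] {τ : A →ₚ[ℂ] ℂ} {G : SimpleGraph ι} {s : ι → A}
    (hs : GIndependentSemicircles τ G s) {q : PCWord G} (hq : q ≠ PCWord.nil) :
    τ (PCWord.wick s q) = 0 := by
  obtain ⟨l, rfl, hl⟩ := q.exists_isReduced
  rw [PCWord.wick_ofSyllables _ hl]
  · rw [show l.map (fun x => Polynomial.aeval (s x.1)
        (Polynomial.Chebyshev.S ℂ ((x.2 + 1 : ℕ) : ℤ))) = List.ofFn fun j : Fin l.length =>
        Polynomial.aeval (s (l.get j).1) (Polynomial.Chebyshev.S ℂ (((l.get j).2 + 1 : ℕ) : ℤ)) by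
      apply List.ext_get <;> simp]
    refine hs.gIndependent.map_prod_eq_zero l.length (fun j => (l.get j).1) ?_ ?_ _ ?_ ?_
    · rw [Nat.one_le_iff_ne_zero, Ne, List.length_eq_zero_iff]
      rintro rfl
      exact hq rfl
    · intro j₁ j₂ h12 h
      obtain ⟨r, h1, h2, h3⟩ := hl.exists_not_adj j₁ j₂ h12 j₂.2 h
      exact ⟨⟨r, h2.trans j₂.2⟩, h1, h2, h3⟩
    · intro j
      exact Polynomial.aeval_mem_adjoin_singleton ℂ _
    · intro j
      exact (hs.isSemicircle _).map_chebyshev_S _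
  · intro i j hij
    exact (hs.gIndependent.classicallyIndependent i j hij).commute _
      (Algebra.self_mem_adjoin_singleton ℂ _) _ (Algebra.self_mem_adjoin_singleton ℂ _)

/-! ### The `ℓ²` norm of finitely supported functions -/

/-- The squared `ℓ²` norm of a finitely supported function. -/
noncomputable def l2NormSq {T : Type*} (f : T →₀ ℂ) : ℝ := f.sum fun _ z => ‖z‖ ^ 2

section L2

variable {T : Type*}

lemma l2NormSq_eq_sum (f : T →₀ ℂ) {S : Finset T} (h : f.support ⊆ S) :
    l2NormSq f = ∑ q ∈ S, ‖f q‖ ^ 2 :=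
  Finsupp.sum_of_support_subset f h _ (by simp)

lemma l2NormSq_nonneg (f : T →₀ ℂ) : 0 ≤ l2NormSq f :=
  Finset.sum_nonneg fun _ _ => by positivity

lemma sq_norm_apply_le_l2NormSq (f : T →₀ ℂ) (q : T) : ‖f q‖ ^ 2 ≤ l2NormSq f := by
  classical
  rw [l2NormSq_eq_sum f (Finset.subset_insert q f.support)]
  exact Finset.single_le_sum (f := fun q => ‖f q‖ ^ 2) (fun _ _ => by positivity)
    (Finset.mem_insert_self _ _)

@[simp] lemma l2NormSq_zero : l2NormSq (0 : T →₀ ℂ) = 0 := Finsupp.sum_zero_index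

lemma l2NormSq_single (q : T) (z : ℂ) : l2NormSq (Finsupp.single q z) = ‖z‖ ^ 2 :=
  Finsupp.sum_single_index (by simp)

lemma sqrt_l2NormSq_add_le (f g : T →₀ ℂ) :
    √(l2NormSq (f + g)) ≤ √(l2NormSq f) + √(l2NormSq g) := by
  classical
  set S := f.support ∪ g.support
  have h : ∀ h : T →₀ ℂ, h.support ⊆ S →
      √(l2NormSq h) = ‖WithLp.toLp 2 (fun q : S => h q)‖ := by
    intro h hS
    rw [EuclideanSpace.norm_eq, l2NormSq_eq_sum h hS, ← Finset.sum_coe_sort]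
  rw [h f Finset.subset_union_left, h g Finset.subset_union_right, h (f + g) Finsupp.support_add]
  exact norm_add_le (WithLp.toLp 2 fun q : S => f q) (WithLp.toLp 2 fun q : S => g q)

lemma l2NormSq_mapDomain {T' : Type*} {φ : T → T'} (hφ : Function.Injective φ) (f : T →₀ ℂ) :
    l2NormSq (f.mapDomain φ) = l2NormSq f :=
  Finsupp.sum_mapDomain_index_inj hφ

/-- A weighted Cauchy-Schwarz inequality. -/
lemma norm_sum_sq_le_of_sum_inv_le_one {ι : Type*} {t : Finset ι} {m : ι → ℝ} (hm : ∀ i, 0 < m i)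
    (ht : ∑ i ∈ t, (m i)⁻¹ ≤ 1) (x : ι → ℂ) : ‖∑ i ∈ t, x i‖ ^ 2 ≤ ∑ i ∈ t, m i * ‖x i‖ ^ 2 := by
  have h := Finset.sum_sq_le_sum_mul_sum_of_sq_le_mul t (r := fun i => ‖x i‖)
    (f := fun i => (m i)⁻¹) (g := fun i => m i * ‖x i‖ ^ 2) (fun i _ => (inv_pos.2 (hm i)).le)
    (fun i _ => mul_nonneg (hm i).le (by positivity))
    (fun i _ => by rw [inv_mul_cancel_left₀ (hm i).ne'])
  refine (pow_le_pow_left₀ (norm_nonneg _) (norm_sum_le _ _) 2).trans (h.trans ?_)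
  exact mul_le_of_le_one_left
    (Finset.sum_nonneg fun i _ => mul_nonneg (hm i).le (by positivity)) ht

end L2

/-! ### Creation and annihilation operators -/

namespace PCWord

variable {ι : Type*} [DecidableEq ι] {G : SimpleGraph ι}

/-- The part of degree `k`: the restriction to words of length `k`. -/
noncomputable def degreePart (k : ℕ) (f : PCWord G →₀ ℂ) : PCWord G →₀ ℂ :=
  f.filter fun q => q.length = k

lemma degreePart_apply (k : ℕ) (f : PCWord G →₀ ℂ) (q : PCWord G) :
    degreePart k f q = if q.length = k then f q else 0 := Finsupp.filter_apply _ _ _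

lemma degreePart_add (k : ℕ) (f g : PCWord G →₀ ℂ) :
    degreePart k (f + g) = degreePart k f + degreePart k g := Finsupp.filter_add

variable [Fintype ι]

/-- The linear combination `∑ i, α i • l i` of the left creation operators
`l i : δ_q ↦ δ_{cons i q}` on finitely supported functions of words. -/
noncomputable def creation (α : ι → ℂ) : (PCWord G →₀ ℂ) →ₗ[ℂ] (PCWord G →₀ ℂ) :=
  ∑ i, α i • Finsupp.lmapDomain ℂ ℂ (cons i)

/-- The linear combination `∑ i, α i • (l i)⋆` of the left annihilation operators, where
`(l i)⋆` maps `δ_{cons i q}` to `δ_q` and `δ_r` to `0` if `i` is not a first letter of `r`. -/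
noncomputable def annihilation (α : ι → ℂ) : (PCWord G →₀ ℂ) →ₗ[ℂ] (PCWord G →₀ ℂ) :=
  ∑ i, α i • Finsupp.lcomapDomain (cons i) (cons_injective i)

lemma creation_apply (α : ι → ℂ) (f : PCWord G →₀ ℂ) (r : PCWord G) :
    creation α f r = ∑ i, α i * f.mapDomain (cons i) r := by
  simp [creation, Finsupp.finsetSum_apply]

lemma annihilation_apply (α : ι → ℂ) (f : PCWord G →₀ ℂ) (q : PCWord G) :
    annihilation α f q = ∑ i, α i * f (cons i q) := by
  simp [annihilation, Finsupp.finsetSum_apply, Finsupp.lcomapDomain, Finsupp.comapDomain_apply]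

lemma degreePart_succ_creation (α : ι → ℂ) (k : ℕ) (f : PCWord G →₀ ℂ) :
    degreePart (k + 1) (creation α f) = creation α (degreePart k f) := by
  ext r
  rw [degreePart_apply, creation_apply, creation_apply]
  have : ∀ i, (degreePart k f).mapDomain (cons i) r =
      if r.length = k + 1 then f.mapDomain (cons i) r else 0 := by
    intro i
    by_cases hr : r ∈ Set.range (cons i)
    · obtain ⟨q, rfl⟩ := hr
      simp [Finsupp.mapDomain_apply (cons_injective i), degreePart_apply]
    · simp [Finsupp.mapDomain_of_notMem_range _ _ hr]
  simp only [this]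
  split_ifs <;> simp

lemma degreePart_zero_creation (α : ι → ℂ) (f : PCWord G →₀ ℂ) :
    degreePart 0 (creation α f) = 0 := by
  ext r
  rw [degreePart_apply, creation_apply]
  split_ifs with h
  · rw [length_eq_zero_iff] at h
    subst h
    refine Finset.sum_eq_zero fun i _ => ?_
    rw [Finsupp.mapDomain_of_notMem_range, mul_zero]
    rintro ⟨q, hq⟩
    exact cons_ne_nil i q hq
  · rfl

lemma degreePart_annihilation (α : ι → ℂ) (k : ℕ) (f : PCWord G →₀ ℂ) :
    degreePart k (annihilation α f) = annihilation α (degreePart (k + 1) f) := by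
  ext r
  rw [degreePart_apply, annihilation_apply, annihilation_apply]
  simp only [degreePart_apply, length_cons, Nat.add_right_cancel_iff]
  split_ifs <;> simp

open scoped Classical in
/-- The norm bound for creation operators: on words whose first letters have reciprocal weights
adding up to at most one, the weighted Cauchy-Schwarz inequality applies. -/
lemma l2NormSq_creation_degreePart_le {m : ι → ℝ} (hm : ∀ i, 0 < m i) {k : ℕ}
    (hk : ∀ r : PCWord G, r.length = k + 1 → ∑ i with i ∈ r.firstLetters, (m i)⁻¹ ≤ 1)
    (α : ι → ℂ) (f : PCWord G →₀ ℂ) :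
    l2NormSq (creation α (degreePart k f)) ≤
      (∑ i, ‖α i‖ ^ 2 * m i) * l2NormSq (degreePart k f) := by
  set g := degreePart k f with hg
  have hpt : ∀ r, ‖creation α g r‖ ^ 2 ≤ ∑ i, ‖α i‖ ^ 2 * m i * ‖g.mapDomain (cons i) r‖ ^ 2 := by
    intro r
    by_cases hr : r.length = k + 1
    · have h0 : ∀ i, i ∉ r.firstLetters → g.mapDomain (cons i) r = 0 := fun i hi =>
        Finsupp.mapDomain_of_notMem_range _ _ hi
      have := norm_sum_sq_le_of_sum_inv_le_one hm (hk r hr) fun i => α i * g.mapDomain (cons i) r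
      rw [creation_apply, ← Finset.sum_filter_of_ne (p := fun i => i ∈ r.firstLetters)]
      · refine this.trans ?_
        refine (Finset.sum_le_sum_of_subset_of_nonneg (Finset.filter_subset _ _)
          fun i _ _ => mul_nonneg (hm i).le (by positivity)).trans_eq ?_
        refine Finset.sum_congr rfl fun i _ => ?_
        rw [norm_mul]
        ring
      · intro i _ hi
        by_contra hc
        simp [h0 i hc] at hi
    · rw [hg, ← degreePart_succ_creation, degreePart_apply, if_neg hr]
      simp only [norm_zero, ne_eq, OfNat.ofNat_ne_zero, not_false_eq_true, zero_pow]
      exact Finset.sum_nonneg fun i _ => mul_nonneg (mul_nonneg (by positivity) (hm i).le)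
        (by positivity)
  set S := (creation α g).support ∪ Finset.univ.biUnion fun i => (g.mapDomain (cons i)).support
  calc l2NormSq (creation α g) = ∑ r ∈ S, ‖creation α g r‖ ^ 2 :=
        l2NormSq_eq_sum _ Finset.subset_union_left
    _ ≤ ∑ r ∈ S, ∑ i, ‖α i‖ ^ 2 * m i * ‖g.mapDomain (cons i) r‖ ^ 2 :=
        Finset.sum_le_sum fun r _ => hpt r
    _ = ∑ i, ‖α i‖ ^ 2 * m i * ∑ r ∈ S, ‖g.mapDomain (cons i) r‖ ^ 2 := by
        rw [Finset.sum_comm]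
        simp only [Finset.mul_sum]
    _ = ∑ i, ‖α i‖ ^ 2 * m i * l2NormSq g := by
        refine Finset.sum_congr rfl fun i _ => ?_
        rw [← l2NormSq_mapDomain (cons_injective i) g, l2NormSq_eq_sum (g.mapDomain (cons i))]
        exact (Finset.subset_biUnion_of_mem (fun i => (g.mapDomain (cons i)).support)
          (Finset.mem_univ i)).trans Finset.subset_union_right
    _ = (∑ i, ‖α i‖ ^ 2 * m i) * l2NormSq g := by rw [Finset.sum_mul]

open scoped Classical in
/-- The norm bound for annihilation operators, dual to `l2NormSq_creation_degreePart_le`. -/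
lemma l2NormSq_annihilation_degreePart_le {m : ι → ℝ} (hm : ∀ i, 0 < m i) {k : ℕ}
    (hk : ∀ r : PCWord G, r.length = k → ∑ i with i ∈ r.firstLetters, (m i)⁻¹ ≤ 1)
    (α : ι → ℂ) (f : PCWord G →₀ ℂ) :
    l2NormSq (annihilation α (degreePart k f)) ≤
      (∑ i, ‖α i‖ ^ 2 * m i) * l2NormSq (degreePart k f) := by
  set g := degreePart k f with hg
  set K := ∑ i, ‖α i‖ ^ 2 * m i
  have hK : 0 ≤ K := Finset.sum_nonneg fun i _ => mul_nonneg (by positivity) (hm i).le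
  have hpt : ∀ q, ‖annihilation α g q‖ ^ 2 ≤ K * ∑ i, (m i)⁻¹ * ‖g (cons i q)‖ ^ 2 := by
    intro q
    rw [annihilation_apply]
    refine (pow_le_pow_left₀ (norm_nonneg _) (norm_sum_le _ _) 2).trans ?_
    refine Finset.sum_sq_le_sum_mul_sum_of_sq_le_mul _
      (fun i _ => mul_nonneg (by positivity) (hm i).le)
      (fun i _ => mul_nonneg (inv_pos.2 (hm i)).le (by positivity)) fun i _ => le_of_eq ?_
    have := (hm i).ne'
    rw [norm_mul]
    field_simp
  set P : ι → Finset (PCWord G) := fun i => g.support.preimage (cons i) (cons_injective i).injOn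
  set S := (annihilation α g).support ∪ Finset.univ.biUnion P
  have hS : ∀ i, ∑ q ∈ S, ‖g (cons i q)‖ ^ 2 =
      ∑ r ∈ g.support, if i ∈ r.firstLetters then ‖g r‖ ^ 2 else 0 := by
    intro i
    rw [← Finset.sum_filter]
    refine Eq.trans ?_ (Finset.sum_preimage' (cons i) g.support (cons_injective i).injOn
      fun r => ‖g r‖ ^ 2)
    refine (Finset.sum_subset ((Finset.subset_biUnion_of_mem P (Finset.mem_univ i)).trans
      Finset.subset_union_right) fun q _ hq => ?_).symm
    simpa [P] using hq
  calc l2NormSq (annihilation α g) = ∑ q ∈ S, ‖annihilation α g q‖ ^ 2 :=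
        l2NormSq_eq_sum _ Finset.subset_union_left
    _ ≤ ∑ q ∈ S, K * ∑ i, (m i)⁻¹ * ‖g (cons i q)‖ ^ 2 := Finset.sum_le_sum fun q _ => hpt q
    _ = K * ∑ i, (m i)⁻¹ * ∑ q ∈ S, ‖g (cons i q)‖ ^ 2 := by
        rw [← Finset.mul_sum, Finset.sum_comm]
        simp only [Finset.mul_sum]
    _ = K * ∑ r ∈ g.support, (∑ i with i ∈ r.firstLetters, (m i)⁻¹) * ‖g r‖ ^ 2 := by
        simp only [hS, Finset.mul_sum, Finset.sum_mul, Finset.sum_filter]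
        rw [Finset.sum_comm]
        simp only [mul_ite, mul_zero, ite_mul, zero_mul]
    _ ≤ K * ∑ r ∈ g.support, ‖g r‖ ^ 2 := by
        refine mul_le_mul_of_nonneg_left (Finset.sum_le_sum fun r hr => ?_) hK
        refine mul_le_of_le_one_left (by positivity) (hk r ?_)
        by_contra hc
        rw [Finsupp.mem_support_iff, hg, degreePart_apply, if_neg hc] at hr
        exact hr rfl
    _ = K * l2NormSq g := rfl

/-- The vectors obtained from the vacuum by applying successively the field operators
`∑ i, γ n i • (l i + (l i)⋆)`. -/
noncomputable def fieldVector (γ : ℕ → ι → ℂ) : ℕ → (PCWord G →₀ ℂ)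
  | 0 => Finsupp.single nil 1
  | n + 1 => creation (γ n) (fieldVector γ n) + annihilation (γ n) (fieldVector γ n)

lemma degreePart_fieldVector_eq_zero (γ : ℕ → ι → ℂ) {n k : ℕ} (h : n < k) :
    degreePart k (fieldVector γ n : PCWord G →₀ ℂ) = 0 := by
  induction n generalizing k with
  | zero =>
    ext q
    rw [degreePart_apply, fieldVector]
    split_ifs with hq
    · refine Finsupp.single_eq_of_ne ?_
      rintro rfl
      rw [length_nil] at hq
      omega
    · rfl
  | succ n ih =>
    obtain ⟨k, rfl⟩ : ∃ k', k = k' + 1 := ⟨k - 1, by omega⟩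
    rw [fieldVector, degreePart_add, degreePart_succ_creation, degreePart_annihilation,
      ih (by omega), ih (by omega), map_zero, map_zero, add_zero]

end PCWord

/-! ### Ballot numbers -/

/-- The number of paths in `ℕ` with `n` steps `±1` from `0` to `k`. -/
def ballot : ℕ → ℕ → ℕ
  | 0, 0 => 1
  | 0, _ + 1 => 0
  | n + 1, 0 => ballot n 1
  | n + 1, k + 1 => ballot n k + ballot n (k + 2)

lemma ballot_eq_zero {n k : ℕ} (h : n < k) : ballot n k = 0 := by
  induction n generalizing k with
  | zero =>
    obtain ⟨k, rfl⟩ : ∃ k', k = k' + 1 := ⟨k - 1, by omega⟩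
    rfl
  | succ n ih =>
    obtain ⟨k, rfl⟩ : ∃ k', k = k' + 1 := ⟨k - 1, by omega⟩
    rw [ballot, ih (by omega), ih (by omega)]

lemma ballot_self (n : ℕ) : ballot n n = 1 := by
  induction n with
  | zero => rfl
  | succ n ih => rw [ballot, ih, ballot_eq_zero (by omega)]

/-- The ballot theorem: `ballot n k` is a difference of two consecutive binomial coefficients. -/
lemma ballot_add_choose (n k j : ℕ) (h : n = k + 2 * (j + 1)) :
    ballot n k + n.choose j = n.choose (j + 1) := by
  induction n generalizing k j with
  | zero => omega
  | succ n ih =>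
    rcases k with _ | k
    · have hsymm : n.choose (j + 1) = n.choose j := by
        obtain rfl : n = 2 * j + 1 := by omega
        exact Nat.choose_symm_half j
      rcases j with _ | j
      · obtain rfl : n = 1 := by omega
        rfl
      · have := ih 1 j (by omega)
        rw [ballot, Nat.choose_succ_succ' n j, Nat.choose_succ_succ' n (j + 1)]
        omega
    · rw [ballot, Nat.choose_succ_succ' n j]
      have h1 := ih k j (by omega)
      rcases j with _ | j
      · obtain rfl : n = k + 2 := by omega
        rw [ballot_self]
        simp at h1 ⊢
        omega
      · have h2 := ih (k + 2) j (by omega)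
        rw [Nat.choose_succ_succ' n j]
        omega

lemma ballot_two_mul (p : ℕ) : ballot (2 * p) 0 = catalan p := by
  rcases p with _ | p
  · simp [ballot]
  · have h1 := ballot_add_choose (2 * (p + 1)) 0 p (by omega)
    have h2 := succ_mul_catalan_eq_centralBinom (p + 1)
    have h3 := Nat.choose_succ_right_eq (2 * (p + 1)) p
    rw [Nat.centralBinom] at h2
    rw [show 2 * (p + 1) - p = p + 2 by omega] at h3
    have : (p + 2) * ballot (2 * (p + 1)) 0 = (p + 2) * catalan (p + 1) := by
      nlinarith
    exact Nat.eq_of_mul_eq_mul_left (by omega) this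

/-! ### Iterated field operators -/

namespace PCWord

variable {ι : Type*} [DecidableEq ι] [Fintype ι] {G : SimpleGraph ι}

open scoped Classical in
/-- Each path from `0` to `k` contributes at most `K ^ (n / 2)` to the norm of the part of degree
`k` of `fieldVector γ n`.  The condition `n + k ≤ 2 * p` singles out the paths that can return
to `0` at time `2 * p`; they stay below height `p`. -/
lemma sqrt_l2NormSq_degreePart_fieldVector_le {m : ι → ℝ} (hm : ∀ i, 0 < m i) {p : ℕ}
    (hp : ∀ r : PCWord G, r.length ≤ p → ∑ i with i ∈ r.firstLetters, (m i)⁻¹ ≤ 1)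
    {γ : ℕ → ι → ℂ} {K : ℝ} (hγ : ∀ n, ∑ i, ‖γ n i‖ ^ 2 * m i = K) (n k : ℕ)
    (h : n + k ≤ 2 * p) :
    √(l2NormSq (degreePart k (fieldVector γ n : PCWord G →₀ ℂ))) ≤ √K ^ n * ballot n k := by
  have hC : ∀ n k, n + k + 2 ≤ 2 * p →
      √(l2NormSq (creation (γ n) (degreePart k (fieldVector γ n : PCWord G →₀ ℂ)))) ≤
      √K * √(l2NormSq (degreePart k (fieldVector γ n : PCWord G →₀ ℂ))) := by
    intro n k h
    by_cases hnk : n < k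
    · simp [degreePart_fieldVector_eq_zero γ hnk]
    rw [← Real.sqrt_mul' _ (l2NormSq_nonneg _), ← hγ n]
    exact Real.sqrt_le_sqrt (l2NormSq_creation_degreePart_le hm
      (fun r hr => hp r (by omega)) _ _)
  have hA : ∀ n k, n + k ≤ 2 * p →
      √(l2NormSq (annihilation (γ n) (degreePart k (fieldVector γ n : PCWord G →₀ ℂ)))) ≤
      √K * √(l2NormSq (degreePart k (fieldVector γ n : PCWord G →₀ ℂ))) := by
    intro n k h
    by_cases hnk : n < k
    · simp [degreePart_fieldVector_eq_zero γ hnk]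
    rw [← Real.sqrt_mul' _ (l2NormSq_nonneg _), ← hγ n]
    exact Real.sqrt_le_sqrt (l2NormSq_annihilation_degreePart_le hm
      (fun r hr => hp r (by omega)) _ _)
  induction n generalizing k with
  | zero =>
    rcases k with _ | k
    · have : degreePart 0 (fieldVector γ 0 : PCWord G →₀ ℂ) = Finsupp.single nil 1 :=
        Finsupp.filter_single_of_pos _ rfl
      simp [this, l2NormSq_single, ballot]
    · simp [degreePart_fieldVector_eq_zero γ (Nat.succ_pos k), ballot]
  | succ n ih =>
    have hK := Real.sqrt_nonneg K
    rcases k with _ | k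
    · rw [fieldVector, degreePart_add, degreePart_zero_creation, degreePart_annihilation, zero_add]
      refine (hA n 1 (by omega)).trans ?_
      refine (mul_le_mul_of_nonneg_left (ih 1 (by omega)) hK).trans_eq ?_
      rw [ballot, pow_succ']
      ring
    · rw [fieldVector, degreePart_add, degreePart_succ_creation, degreePart_annihilation]
      refine (sqrt_l2NormSq_add_le _ _).trans ?_
      refine (add_le_add ((hC n k (by omega)).trans (mul_le_mul_of_nonneg_left
        (ih k (by omega)) hK)) ((hA n (k + 2) (by omega)).trans (mul_le_mul_of_nonneg_left
        (ih (k + 2) (by omega)) hK))).trans_eq ?_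
      rw [ballot, pow_succ']
      push_cast
      ring

end PCWord

/-! ### Moments as vacuum expectations -/

namespace PCWord

/-- The field operators on functions of words implement left multiplication by linear
combinations of the `s i` on Wick products. -/
lemma linearCombination_wick_field {ι A : Type*} [DecidableEq ι] [Fintype ι] {G : SimpleGraph ι}
    [Ring A] [Algebra ℂ A] {s : ι → A} (hs : ∀ i j, G.Adj i j → s i * s j = s j * s i)
    (α : ι → ℂ) (f : PCWord G →₀ ℂ) :
    Finsupp.linearCombination ℂ (wick s) (creation α f + annihilation α f) =
      (∑ i, α i • s i) * Finsupp.linearCombination ℂ (wick s) f := by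
  classical
  have hi : ∀ i, ∀ q : PCWord G, wickRemove s i q = Finsupp.linearCombination ℂ (wick s)
      (Finsupp.lcomapDomain (R := ℂ) (M := ℂ) (cons i) (cons_injective i)
        (Finsupp.single q 1)) := by
    intro i q
    by_cases hq : i ∈ q.firstLetters
    · obtain ⟨t, rfl⟩ := hq
      have : Finsupp.lcomapDomain (R := ℂ) (M := ℂ) (cons i) (cons_injective i)
          (Finsupp.single (cons i t) 1) = Finsupp.single t 1 :=
        Finsupp.comapDomain_single _ _ _ (cons_injective i).injOn
      rw [wickRemove_cons_self, this, Finsupp.linearCombination_single, one_smul]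
    · have : Finsupp.lcomapDomain (R := ℂ) (M := ℂ) (cons i) (cons_injective i)
          (Finsupp.single q 1) = 0 :=
        Finsupp.comapDomain_single_of_not_mem_range hq _ (cons_injective i).injOn
      rw [wickRemove_of_notMem s hq, this, map_zero]
  induction f using Finsupp.induction_linear with
  | zero => simp
  | add f g hf hg =>
    rw [map_add (creation α), map_add (annihilation α), add_add_add_comm, map_add, hf, hg,
      map_add, mul_add]
  | single q c =>
    rw [← mul_one c, ← smul_eq_mul, ← Finsupp.smul_single, map_smul, map_smul, ← smul_add, map_smul,
      map_smul, mul_smul_comm]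
    congr 1
    rw [Finsupp.linearCombination_single, one_smul, Finset.sum_mul, creation, annihilation,
      LinearMap.sum_apply, LinearMap.sum_apply, ← Finset.sum_add_distrib, map_sum]
    refine Finset.sum_congr rfl fun i _ => ?_
    rw [LinearMap.smul_apply, LinearMap.smul_apply, ← smul_add, map_smul, map_add, ← hi,
      Finsupp.lmapDomain_apply, Finsupp.mapDomain_single, Finsupp.linearCombination_single,
      one_smul, wick_cons hs, sub_add_cancel, smul_mul_assoc]

end PCWord

/-- The vacuum expectation computes the trace. -/
lemma GIndependentSemicircles.map_linearCombination_wick {A ι : Type*} [DecidableEq ι]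
    [CStarAlgebra A] [PartialOrder A] {τ : A →ₚ[ℂ] ℂ} {G : SimpleGraph ι} {s : ι → A}
    (h1 : τ 1 = 1) (hs : GIndependentSemicircles τ G s) (f : PCWord G →₀ ℂ) :
    τ (Finsupp.linearCombination ℂ (PCWord.wick s) f) = f PCWord.nil := by
  induction f using Finsupp.induction_linear with
  | zero => simp
  | add f g hf hg => rw [map_add, map_add, hf, hg, Finsupp.add_apply]
  | single q c =>
    rw [Finsupp.linearCombination_single, map_smul, smul_eq_mul]
    by_cases hq : q = PCWord.nil
    · rw [hq, PCWord.wick_nil, h1, mul_one, Finsupp.single_eq_same]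
    · rw [hs.map_wick hq, mul_zero, Finsupp.single_eq_of_ne (Ne.symm hq)]

open scoped Classical in
/-- The moment estimate for arbitrary weights whose reciprocals add up to at most one over the
first letters of each word of length at most `p`. -/
lemma GIndependentSemicircles.re_map_pow_le {A ι : Type*} [DecidableEq ι] [Fintype ι]
    [CStarAlgebra A] [PartialOrder A] {τ : A →ₚ[ℂ] ℂ} {G : SimpleGraph ι} {s : ι → A}
    (h1 : τ 1 = 1) (hs : GIndependentSemicircles τ G s) {m : ι → ℝ} (hm : ∀ i, 0 < m i) {p : ℕ}
    (hp : ∀ r : PCWord G, r.length ≤ p → ∑ i with i ∈ r.firstLetters, (m i)⁻¹ ≤ 1)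
    (α : ι → ℂ) :
    (τ (((∑ i, α i • s i) * star (∑ i, α i • s i)) ^ p)).re ≤
      catalan p * (∑ i, ‖α i‖ ^ 2 * m i) ^ p := by
  set u := ∑ i, α i • s i with hu
  set K := ∑ i, ‖α i‖ ^ 2 * m i with hK
  have hK0 : 0 ≤ K := Finset.sum_nonneg fun i _ => mul_nonneg (by positivity) (hm i).le
  have hstar : star u = ∑ i, star (α i) • s i := by
    rw [hu, star_sum]
    exact Finset.sum_congr rfl fun i _ => by
      rw [star_smul, (hs.isSemicircle i).isSelfAdjoint.star_eq]
  have hcomm : ∀ i j, G.Adj i j → s i * s j = s j * s i := fun i j hij =>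
    (hs.gIndependent.classicallyIndependent i j hij).commute _
      (Algebra.self_mem_adjoin_singleton ℂ _) _ (Algebra.self_mem_adjoin_singleton ℂ _)
  -- The factors `star u` and `u` alternate, starting with `star u` on the right.
  set γ : ℕ → ι → ℂ := fun n i => if Even n then star (α i) else α i with hγ
  have hvec : ∀ n, Finsupp.linearCombination ℂ (PCWord.wick s)
      (PCWord.fieldVector γ (2 * n) : PCWord G →₀ ℂ) = (u * star u) ^ n := by
    intro n
    induction n with
    | zero => simp [PCWord.fieldVector]
    | succ n ih =>
      have e0 : γ (2 * n) = fun i => star (α i) := by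
        funext i
        exact if_pos (even_two_mul n)
      have e1 : γ (2 * n + 1) = α := by
        funext i
        exact if_neg (by simp)
      rw [show 2 * (n + 1) = 2 * n + 1 + 1 by ring, PCWord.fieldVector,
        PCWord.linearCombination_wick_field hcomm, PCWord.fieldVector,
        PCWord.linearCombination_wick_field hcomm, ih, e0, e1, ← hstar, ← hu, pow_succ', mul_assoc]
  have hbound := PCWord.sqrt_l2NormSq_degreePart_fieldVector_le hm hp (γ := γ) (K := K)
    (fun n => by
      rw [hK]
      refine Finset.sum_congr rfl fun i _ => ?_
      simp only [hγ]
      split_ifs <;> simp) (2 * p) 0 (by omega)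
  rw [← hvec, hs.map_linearCombination_wick h1]
  refine (Complex.re_le_norm _).trans ?_
  have hdeg : (PCWord.fieldVector γ (2 * p) : PCWord G →₀ ℂ) PCWord.nil =
      PCWord.degreePart 0 (PCWord.fieldVector γ (2 * p) : PCWord G →₀ ℂ) PCWord.nil := by
    rw [PCWord.degreePart_apply, PCWord.length_nil, if_pos rfl]
  rw [hdeg]
  refine (Real.le_sqrt_of_sq_le (sq_norm_apply_le_l2NormSq _ _)).trans (hbound.trans_eq ?_)
  rw [pow_mul, Real.sq_sqrt hK0, ballot_two_mul, mul_comm]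

lemma sum_inv_le_one_of_card_le {ι : Type*} {t : Finset ι} {m : ι → ℝ}
    (h : ∀ i ∈ t, (t.card : ℝ) ≤ m i) : ∑ i ∈ t, (m i)⁻¹ ≤ 1 := by
  rcases t.eq_empty_or_nonempty with rfl | ht
  · simp
  have hc : (0 : ℝ) < t.card := by exact_mod_cast ht.card_pos
  calc ∑ i ∈ t, (m i)⁻¹ ≤ ∑ _i ∈ t, (t.card : ℝ)⁻¹ :=
        Finset.sum_le_sum fun i hi => inv_anti₀ hc (h i hi)
    _ = 1 := by rw [Finset.sum_const, nsmul_eq_mul, mul_inv_cancel₀ hc.ne']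

/-! ### Clique weights and the norm inequality -/

section CliqueNumAt

variable {ι : Type*} [Fintype ι] {G : SimpleGraph ι}

lemma bddAbove_card_clique_mem (i : ι) :
    BddAbove {n | ∃ t : Finset ι, G.IsNClique n t ∧ i ∈ t} :=
  ⟨Fintype.card ι, by rintro n ⟨t, ht, -⟩; exact ht.card_eq ▸ Finset.card_le_univ t⟩

lemma card_le_cliqueNumAt {i : ι} {t : Finset ι} (ht : G.IsClique t) (hi : i ∈ t) :
    t.card ≤ cliqueNumAt G i :=
  le_csSup (bddAbove_card_clique_mem i) ⟨t, ⟨ht, rfl⟩, hi⟩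

lemma cliqueNumAt_pos (i : ι) : 0 < cliqueNumAt G i := by
  have := card_le_cliqueNumAt (G := G) (t := {i}) (by simp) (Finset.mem_singleton_self i)
  rwa [Finset.card_singleton] at this

lemma cliqueNumAt_le_cliqueNum (i : ι) : cliqueNumAt G i ≤ G.cliqueNum := by
  refine csSup_le ⟨1, {i}, ⟨by simp, rfl⟩, Finset.mem_singleton_self i⟩ ?_
  rintro n ⟨t, ht, -⟩
  exact ht.card_eq ▸ ht.isClique.card_le_cliqueNum

end CliqueNumAt

theorem theorem1p1 {A : Type*} [CStarAlgebra A] [PartialOrder A] [StarOrderedRing A]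
    (τ : A →ₚ[ℂ] ℂ) (hτ : IsFaithfulTracialState τ)
    (L : ℕ) (G : SimpleGraph (Fin L)) (s : Fin L → A) (hs : GIndependentSemicircles τ G s)
    (α : Fin L → ℂ) (p : ℕ) (hp : 1 ≤ p) :
    ncNorm τ p (∑ i, α i • s i) ≤
        (catalan p : ℝ) ^ (1 / (2 * (p : ℝ))) *
          √(min (∑ i, ‖α i‖ ^ 2 * (cliqueNumAt G i : ℝ)) ((p : ℝ) * ∑ i, ‖α i‖ ^ 2)) ∧
      ncNorm τ p (∑ i, α i • s i) ≤
        (catalan p : ℝ) ^ (1 / (2 * (p : ℝ))) *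
          √(min (G.cliqueNum : ℝ) (p : ℝ)) * √(∑ i, ‖α i‖ ^ 2) := by
  classical
  have hp0 : (p : ℝ) ≠ 0 := by positivity
  have hclique := hs.re_map_pow_le hτ.map_one (m := fun i => (cliqueNumAt G i : ℝ))
    (fun i => by exact_mod_cast cliqueNumAt_pos i) (p := p) (fun r _ => by
      refine sum_inv_le_one_of_card_le fun i hi => ?_
      refine Nat.cast_le.2 (card_le_cliqueNumAt (r.isClique_firstLetters.subset ?_) hi)
      intro j hj
      simpa using hj) α
  have hlength := hs.re_map_pow_le hτ.map_one (m := fun _ => (p : ℝ))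
    (fun i => by positivity) (p := p) (fun r hr => by
      refine sum_inv_le_one_of_card_le fun i _ => Nat.cast_le.2 (le_trans ?_ hr)
      refine PCWord.card_le_length_of_subset_firstLetters fun j hj => ?_
      simpa using hj) α
  rw [← Finset.sum_mul, mul_comm _ (p : ℝ)] at hlength
  set u := ∑ i, α i • s i
  have h0 : 0 ≤ (τ ((u * star u) ^ p)).re := by
    have : 0 ≤ τ ((u * star u) ^ p) :=
      map_nonneg τ (CStarAlgebra.pow_nonneg (mul_star_self_nonneg u) p)
    exact (Complex.nonneg_iff.1 this).1
  have key : ∀ K : ℝ, 0 ≤ K → (τ ((u * star u) ^ p)).re ≤ catalan p * K ^ p →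
      ncNorm τ p u ≤ (catalan p : ℝ) ^ (1 / (2 * (p : ℝ))) * √K := by
    intro K hK h
    refine (Real.rpow_le_rpow h0 h (by positivity)).trans_eq ?_
    rw [Real.mul_rpow (by positivity) (by positivity), Real.sqrt_eq_rpow, ← Real.rpow_natCast,
      ← Real.rpow_mul hK]
    congr 2
    field_simp
  have hS : 0 ≤ ∑ i, ‖α i‖ ^ 2 := by positivity
  have h : ncNorm τ p u ≤ (catalan p : ℝ) ^ (1 / (2 * (p : ℝ))) *
      √(min (∑ i, ‖α i‖ ^ 2 * (cliqueNumAt G i : ℝ)) ((p : ℝ) * ∑ i, ‖α i‖ ^ 2)) := by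
    refine key _ (by positivity) ?_
    rcases min_choice (∑ i, ‖α i‖ ^ 2 * (cliqueNumAt G i : ℝ)) ((p : ℝ) * ∑ i, ‖α i‖ ^ 2) with
      hmin | hmin
    · rwa [hmin]
    · rwa [hmin]
  refine ⟨h, h.trans ?_⟩
  rw [mul_assoc, ← Real.sqrt_mul' _ hS, min_mul_of_nonneg _ _ hS]
  refine mul_le_mul_of_nonneg_left (Real.sqrt_le_sqrt (min_le_min_right _ ?_)) (by positivity)
  rw [Finset.mul_sum]
  refine Finset.sum_le_sum fun i _ => ?_
  rw [mul_comm]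
  gcongr
  exact cliqueNumAt_le_cliqueNum i
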